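/- Let $(W,S)$ be a finite Weyl group (a finite crystallographic Coxeter group) with a decomposition $S=S_+\sqcup S_-$ such that no element of $S_+$ is conjugate in $W$ to an element of $S_-$. Let $\phi:S\to\mathbb{Z}$ satisfy $(\star)$ $\phi$ is constant on $S_+$ and constant on $S_-$, and let $|\phi|:S\to\mathbb{Z}$, $s\mapsto|\phi(s)|$. Let $\varepsilon$ be the linear character of $W$ with $\varepsilon(s)=-1$ if $\phi(s)<0$ and $\varepsilon(s)=1$ if $\phi(s)\ge 0$. Let $(E^{\lambda})_{\lambda\in\Lambda}$ be a complete list, without repetition, of the simple $\mathbb{C}[W]$-modules, and let $\lambda^{\varepsilon}\in\Lambda$ be such that $E^{\lambda^{\varepsilon}}\cong E^{\lambda}\otimes\varepsilon$. *The $a$-function.* Let $A=\mathbb{Z}[q^{1/2},q^{-1/2}]$ and $K=\operatorname{Frac}(A)$, let $\mathcal{H}(W,S,\phi)$ be the Iwahori–Hecke algebra over $A$ with basis $(T_w)_{w\in W}$ and relations $T_wT_{w'}=T_{ww'}$ if $\ell(ww')=\ell(w)+\ell(w')$, and $(T_s-q^{\phi(s)})(T_s+1)=0$ for $s\in S$,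 and let $\mathcal{H}_K(W,S,\phi)=K\otimes_A\mathcal{H}(W,S,\phi)$. Let $V^{\lambda}_{\phi}$ be the simple $\mathcal{H}_K(W,S,\phi)$-module whose character specializes to that of $E^{\lambda}$ under $q^{1/2}\mapsto 1$ (Tits' deformation theorem). The Schur elements $c_\lambda$ are defined by $\tau(T_w)=\sum_{\lambda\in\Lambda}\frac{1}{c_\lambda}\operatorname{trace}(T_w,V^\lambda_\phi)$ for all $w\in W$, where $\tau(T_1)=1$ and $\tau(T_w)=0$ for $w\neq 1$. Then $a^{\phi}(E^\lambda)\in\mathbb{N}$ is defined by $c_\lambda=f_\lambda q^{-a^\phi(E^\lambda)}+{}$(combination of higher powers of $q$), with $f_\lambda$ a positive integer. The same definitions apply to every parabolic subgroup $(W_I,I)$, $I\subset S$, with $\phi_I=\phi|_I$. *Constructible modules.* For $I\subset S$ and a simple $\mathbb{C}[W_I]$-module $U$, let $\mathbf{J}_I^S(U)$ be the sum of the isotypic components of $\operatorname{Ind}_{W_I}^{W}(U)$ belonging to the simple $\mathbb{C}[W]$-modules $E$ with $a^{\phi}(E)=a^{\phi_I}(U)$; extend $\mathbf{J}_I^S$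 additively to all finite-dimensional $\mathbb{C}[W_I]$-modules. The $\mathbb{C}[W]$-modules that are constructible with respect to $\phi$ are defined inductively, up to isomorphism: if $W=\{1\}$, only the trivial module is constructible; if $W\neq\{1\}$, the constructible modules are those of the form $\mathbf{J}_I^S(V)$ or $\operatorname{sgn}\otimes\mathbf{J}_I^S(V)$, where $I\subsetneq S$, $V$ is a $\mathbb{C}[W_I]$-module that is constructible with respect to $\phi_I$, and $\operatorname{sgn}$ is the sign representation of $W$. **Proposition.** For every family $(\alpha_\lambda)_{\lambda\in\Lambda}$ of non-negative integers, the $\mathbb{C}[W]$-module $\bigoplus_{\lambda\in\Lambda}\alpha_\lambda E^{\lambda}$ (the specialization of $\bigoplus_\lambda\alpha_\lambda V^{\lambda}_{\phi}$ at $q^{1/2}=1$) is constructible with respect to $\phi$ if and only if the $\mathbb{C}[W]$-module $\bigoplus_{\lambda\in\Lambda}\alpha_\lambda E^{\lambda^{\varepsilon}}$ (the specialization of $\bigoplus_\lambda\alpha_\lambda V^{\lambda^{\varepsilon}}_{|\phi|}$ at $q^{1/2}=1$) is constructible with respect to $|\phi|$. -/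

import Mathlib

open scoped LaurentPolynomial TensorProduct

universe u b v w

namespace ConstructibleHecke

noncomputable section

/-! ### Weyl groups and parabolic subgroups -/

/-- The crystallographic condition on a Coxeter matrix; a finite Coxeter group is a
finite Weyl group exactly when its matrix satisfies it. -/
def IsCrystallographic {B : Type b} (M : CoxeterMatrix B) : Prop :=
  ∀ i j : B, i ≠ j → M i j = 2 ∨ M i j = 3 ∨ M i j = 4 ∨ M i j = 6

/-- The length `ℓ(g)` of `g` with respect to a family of generators `s`: the smallest
length of a word in the generators with product `g`. -/
def wordLength {B : Type b} {G : Type u} [Group G] (s : B → G) (g : G) : ℕ :=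
  sInf {n : ℕ | ∃ l : List B, l.length = n ∧ (l.map s).prod = g}

/-- The standard parabolic subgroup `W_I`. -/
abbrev parabolic {B : Type b} {G : Type u} [Group G] (s : B → G) (I : Set B) : Subgroup G :=
  Subgroup.closure (s '' I)

/-- The generators of the parabolic subgroup `W_I`, indexed by `I`. -/
def parabolicGen {B : Type b} {G : Type u} [Group G] (s : B → G) (I : Set B) (i : I) :
    parabolic s I :=
  ⟨s i, Subgroup.subset_closure ⟨i, i.2, rfl⟩⟩

/-! ### The Iwahori-Hecke algebra -/

/-- The ring `A = ℤ[q^{1/2}, q^{-1/2}]`; the Laurent variable `T 1` is `q^{1/2}`. -/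
abbrev A : Type := LaurentPolynomial ℤ

/-- The field of fractions of `A`. -/
abbrev K : Type := FractionRing A

/-- `q ^ n`, where `q = (q^{1/2})^2`. -/
def qpow (n : ℤ) : A := LaurentPolynomial.T (2 * n)

/-- The specialization `A → ℂ` sending `q^{1/2}` to `1`. -/
def specOne : A →+* ℂ := LaurentPolynomial.eval₂ (Int.castRingHom ℂ) (1 : ℂˣ)

/-- The defining relations of the Hecke algebra, in generators `T_w`, `w ∈ G`. -/
inductive HeckeRel {B : Type b} {G : Type u} [Group G] (s : B → G) (φ : B → ℤ) :
    FreeAlgebra A G → FreeAlgebra A G → Prop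
  | one : HeckeRel s φ (FreeAlgebra.ι A (1 : G)) 1
  | mul (x y : G) (h : wordLength s (x * y) = wordLength s x + wordLength s y) :
      HeckeRel s φ (FreeAlgebra.ι A x * FreeAlgebra.ι A y) (FreeAlgebra.ι A (x * y))
  | quad (i : B) :
      HeckeRel s φ
        ((FreeAlgebra.ι A (s i) - algebraMap A (FreeAlgebra A G) (qpow (φ i))) *
          (FreeAlgebra.ι A (s i) + 1)) 0

/-- The Iwahori-Hecke algebra `H(W, S, φ)` over `A`. -/
abbrev HeckeAlgebra {B : Type b} {G : Type u} [Group G] (s : B → G) (φ : B → ℤ) : Type u :=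
  RingQuot (HeckeRel s φ)

/-- The algebra `H_K(W, S, φ) = K ⊗_A H(W, S, φ)`. -/
abbrev HeckeAlgebraK {B : Type b} {G : Type u} [Group G] (s : B → G) (φ : B → ℤ) : Type u :=
  K ⊗[A] HeckeAlgebra s φ

/-- The element `T_g` of `H_K(W, S, φ)`. -/
def heckeT {B : Type b} {G : Type u} [Group G] (s : B → G) (φ : B → ℤ) (g : G) :
    HeckeAlgebraK s φ :=
  (1 : K) ⊗ₜ[A] RingQuot.mkAlgHom A (HeckeRel s φ) (FreeAlgebra.ι A g)

/-- A matrix representation `H_K(W, S, φ) → M_d(K)`. -/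
structure HeckeRep {B : Type b} {G : Type u} [Group G] (s : B → G) (φ : B → ℤ) where
  dim : ℕ
  toAlgHom : HeckeAlgebraK s φ →ₐ[K] Matrix (Fin dim) (Fin dim) K

namespace HeckeRep

variable {B : Type b} {G : Type u} [Group G] {s : B → G} {φ : B → ℤ}

/-- `trace (T_g, V)`. -/
def traceT (V : HeckeRep s φ) (g : G) : K := (V.toAlgHom (heckeT s φ g)).trace

/-- The module `K^d` afforded by the representation is simple. -/
def IsSimple (V : HeckeRep s φ) : Prop :=
  V.dim ≠ 0 ∧ ∀ p : Submodule K (Fin V.dim → K),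
    (∀ h : HeckeAlgebraK s φ, ∀ x ∈ p, (V.toAlgHom h).mulVec x ∈ p) → p = ⊥ ∨ p = ⊤

/-- Isomorphism of the modules afforded by two representations. -/
def IsIso (V V' : HeckeRep s φ) : Prop :=
  ∃ e : (Fin V.dim → K) ≃ₗ[K] (Fin V'.dim → K),
    ∀ (h : HeckeAlgebraK s φ) (x : Fin V.dim → K),
      e ((V.toAlgHom h).mulVec x) = (V'.toAlgHom h).mulVec (e x)

/-- `V` is a complete list, without repetition, of the simple `H_K(W, S, φ)`-modules. -/
def IsCompleteList {n : ℕ} (V : Fin n → HeckeRep s φ) : Prop :=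
  (∀ i, (V i).IsSimple) ∧ (∀ i j, (V i).IsIso (V j) → i = j) ∧
    ∀ U : HeckeRep s φ, U.IsSimple → ∃ i, U.IsIso (V i)

open Classical in
/-- `c` is the Schur element of the simple module `V`: it is the coefficient belonging to `V` in
the expansion `τ(T_g) = ∑_λ (1 / c_λ) trace (T_g, V^λ)` of the symmetrizing trace `τ`, where
`τ(T_1) = 1` and `τ(T_g) = 0` for `g ≠ 1`. -/
def IsSchurElement (V : HeckeRep s φ) (c : K) : Prop :=
  ∃ (n : ℕ) (U : Fin n → HeckeRep s φ) (d : Fin n → K),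
    IsCompleteList U ∧ (∀ i, d i ≠ 0) ∧
    (∀ g : G, ∑ i, (d i)⁻¹ * (U i).traceT g = if g = 1 then 1 else 0) ∧
    ∃ i, V.IsIso (U i) ∧ c = d i

/-- The `ℂ[G]`-module `E` is the specialization of `V` at `q^{1/2} = 1` (the correspondence of
Tits' deformation theorem): the traces of the `T_g` on `V` lie in `A` and specialize to the
character of `E`. -/
def SpecializesTo (V : HeckeRep s φ) {X : Type v} [AddCommGroup X] [Module ℂ X]
    (E : Representation ℂ G X) : Prop :=
  ∀ g : G, ∃ a : A, algebraMap A K a = V.traceT g ∧ specOne a = E.character g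

end HeckeRep

/-! ### Lusztig's `a`-function -/

/-- `a^φ(E) = n` for a simple `ℂ[G]`-module `E`: if `V` is the simple `H_K(W, S, φ)`-module
specializing to `E`, then its Schur element lies in `A` and is of the form
`f q^{-n} + (combination of higher powers of q)` with `f > 0`. (The coefficient of `q^{k/2}` in
`c` is `c.coeff k`.) -/
def HasAValue {B : Type b} {G : Type u} [Group G] (s : B → G) (φ : B → ℤ)
    {X : Type v} [AddCommGroup X] [Module ℂ X] (E : Representation ℂ G X) (n : ℕ) : Prop :=
  ∃ V : HeckeRep s φ, V.IsSimple ∧ V.SpecializesTo E ∧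
    ∃ c : A, V.IsSchurElement (algebraMap A K c) ∧
      0 < c.coeff (-(2 * (n : ℤ))) ∧ ∀ k : ℤ, k < -(2 * (n : ℤ)) → c.coeff k = 0

/-! ### Truncated induction and constructible representations -/

/-- The part `U_{(n)}` of a representation `U`: the sum of all its simple
subrepresentations with `a`-value `n`. -/
def truncation {B : Type b} {G : Type u} [Group G] (s : B → G) (φ : B → ℤ)
    {X : Type v} [AddCommGroup X] [Module ℂ X] (ρ : Representation ℂ G X) (n : ℕ) :
    Subrepresentation ρ where
  toSubmodule :=
    ⨆ p : {p : Subrepresentation ρ //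
      p.toRepresentation.IsIrreducible ∧ HasAValue s φ p.toRepresentation n}, p.1.toSubmodule
  apply_mem_toSubmodule g x hx := by
    refine Submodule.iSup_induction _ (motive := fun x => ρ g x ∈ _) hx ?_ ?_ ?_
    · intro p y hy
      exact Submodule.mem_iSup_of_mem p (p.1.apply_mem_toSubmodule g hy)
    · simp
    · intro y z hy hz
      rw [map_add]
      exact Submodule.add_mem _ hy hz

/-- The truncated induction `J_I^S`. For a simple `ρ` with `a`-value `n` it is
`(Ind_I^S ρ)_{(n)}`; in general it is extended additively, by splitting `ρ` into its
parts `ρ_{(n)}`. -/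
def jInd {B : Type b} {G : Type u} [Group G] (s : B → G) (φ : B → ℤ) (I : Set B)
    {X : Type v} [AddCommGroup X] [Module ℂ X] (ρ : Representation ℂ (parabolic s I) X) :=
  Representation.directSum fun n : ℕ =>
    (truncation s φ
      (Representation.ind (parabolic s I).subtype
        (truncation (parabolicGen s I) (I.domRestrict φ) ρ n).toRepresentation) n).toRepresentation

/-- The twist `ρ ⊗ χ` of a representation by a linear character with values in `{1, -1}`. -/
def twist {G : Type u} [Group G] (χ : G →* ℤˣ) {X : Type v} [AddCommGroup X] [Module ℂ X]
    (ρ : Representation ℂ G X) : Representation ℂ G X where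
  toFun g := (((χ g : ℤˣ) : ℤ) : ℂ) • ρ g
  map_one' := by simp
  map_mul' g h := by simp [smul_smul, mul_comm]

/-- Constructible representations with respect to `φ`. -/
inductive IsConstructible : ∀ {B : Type b} {G : Type u} [Group G] (_ : B → G) (_ : B → ℤ)
    {X : Type v} [AddCommGroup X] [Module ℂ X] (_ : Representation ℂ G X), Prop
  | base {B : Type b} {G : Type u} [Group G] (s : B → G) (φ : B → ℤ)
      {X : Type v} [AddCommGroup X] [Module ℂ X] (ρ : Representation ℂ G X)
      (hG : Subsingleton G) (hX : Module.finrank ℂ X = 1) :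
      IsConstructible s φ ρ
  | truncInd {B : Type b} {G : Type u} [Group G] (s : B → G) (φ : B → ℤ)
      {X : Type v} [AddCommGroup X] [Module ℂ X] (ρ : Representation ℂ G X)
      (hG : Nontrivial G) (I : Set B) (hI : I ≠ Set.univ)
      {Y : Type v} [AddCommGroup Y] [Module ℂ Y] (σ : Representation ℂ (parabolic s I) Y)
      (hσ : IsConstructible (parabolicGen s I) (I.domRestrict φ) σ)
      (hρ : Nonempty (ρ.Equiv (jInd s φ I σ))) :
      IsConstructible s φ ρ
  | sgnTruncInd {B : Type b} {G : Type u} [Group G] (s : B → G) (φ : B → ℤ)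
      {X : Type v} [AddCommGroup X] [Module ℂ X] (ρ : Representation ℂ G X)
      (hG : Nontrivial G) (I : Set B) (hI : I ≠ Set.univ)
      {Y : Type v} [AddCommGroup Y] [Module ℂ Y] (σ : Representation ℂ (parabolic s I) Y)
      (hσ : IsConstructible (parabolicGen s I) (I.domRestrict φ) σ)
      (sgn : G →* ℤˣ) (hsgn : ∀ i, sgn (s i) = -1)
      (hρ : Nonempty (ρ.Equiv (twist sgn (jInd s φ I σ)))) :
      IsConstructible s φ ρ

/-! ### The set-up of the statement -/

/-- `E` is a complete list, without repetition, of the simple `ℂ[G]`-modules. -/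
def IsIrrList {G : Type u} [Group G] {Λ : Type w} {X : Λ → Type v}
    [∀ l, AddCommGroup (X l)] [∀ l, Module ℂ (X l)]
    (E : ∀ l, Representation ℂ G (X l)) : Prop :=
  (∀ l, (E l).IsIrreducible) ∧ (∀ l m, Nonempty ((E l).Equiv (E m)) → l = m) ∧
    ∀ (Y : Type v) [AddCommGroup Y] [Module ℂ Y] (F : Representation ℂ G Y),
      F.IsIrreducible → ∃ l, Nonempty (F.Equiv (E l))

/-- The condition `(⋆)` for the decomposition `S = S₊ ⊔ S₋`. -/
def Star {B : Type b} (Sp Sm : Set B) (φ : B → ℤ) : Prop :=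
  (∀ i ∈ Sp, ∀ j ∈ Sp, φ i = φ j) ∧ (∀ i ∈ Sm, ∀ j ∈ Sm, φ i = φ j)

theorem isConj_simple_of_odd {B : Type b} {W : Type u} [Group W] {M : CoxeterMatrix B}
    (cs : CoxeterSystem M W) {i j : B} (h : Odd (M i j)) :
    IsConj (cs.simple i) (cs.simple j) := by
  obtain ⟨k, hk⟩ := h
  have hp := cs.simple_mul_simple_pow i j
  set r := cs.simple i * cs.simple j with hr
  have h1 : SemiconjBy (cs.simple i) r⁻¹ r := by
    simp [SemiconjBy, hr, mul_assoc]
  have h2 : cs.simple i * (r⁻¹) ^ k = r ^ k * cs.simple i := h1.pow_right k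
  refine isConj_iff.mpr ⟨r ^ k, ?_⟩
  have h3 : r ^ k * r ^ k = r⁻¹ := by
    rw [eq_inv_iff_mul_eq_one, ← pow_add, ← pow_succ, ← hp, hk]
    congr 1
    ring
  calc r ^ k * cs.simple i * (r ^ k)⁻¹ = r ^ k * (cs.simple i * (r⁻¹) ^ k) := by
        rw [inv_pow, mul_assoc]
    _ = r ^ k * r ^ k * cs.simple i := by rw [h2, mul_assoc]
    _ = cs.simple j := by rw [h3, hr]; simp [mul_assoc]

theorem Star.eq_of_isConj {B : Type b} {W : Type u} [Group W] {M : CoxeterMatrix B}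
    (cs : CoxeterSystem M W) {Sp Sm : Set B} (hS : IsCompl Sp Sm)
    (hconj : ∀ i ∈ Sp, ∀ j ∈ Sm, ¬ IsConj (cs.simple i) (cs.simple j))
    {φ : B → ℤ} (hφ : Star Sp Sm φ) {i j : B} (h : IsConj (cs.simple i) (cs.simple j)) :
    φ i = φ j := by
  have key : ∀ k : B, k ∈ Sp ∨ k ∈ Sm := fun k => by
    have : k ∈ Sp ⊔ Sm := by rw [hS.sup_eq_top]; trivial
    exact this
  rcases key i with hi | hi <;> rcases key j with hj | hj
  · exact hφ.1 i hi j hj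
  · exact absurd h (hconj i hi j hj)
  · exact absurd h.symm (hconj j hj i hi)
  · exact hφ.2 i hi j hj

/-- The linear character `ε` of `W` with `ε(s) = -1` if `φ(s) < 0` and `ε(s) = 1`
otherwise. -/
def epsilon {B : Type b} {W : Type u} [Group W] {M : CoxeterMatrix B}
    (cs : CoxeterSystem M W) {Sp Sm : Set B} (hS : IsCompl Sp Sm)
    (hconj : ∀ i ∈ Sp, ∀ j ∈ Sm, ¬ IsConj (cs.simple i) (cs.simple j))
    (φ : B → ℤ) (hφ : Star Sp Sm φ) : W →* ℤˣ :=
  cs.lift ⟨fun i => if φ i < 0 then -1 else 1, by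
    intro i j
    rcases Nat.even_or_odd (M i j) with ⟨k, hk⟩ | ho
    · rw [hk, ← two_mul, pow_mul, sq, Int.units_mul_self, one_pow]
    · simp only [hφ.eq_of_isConj cs hS hconj (isConj_simple_of_odd cs ho),
        Int.units_mul_self, one_pow]⟩

theorem epsilon_simple {B : Type b} {W : Type u} [Group W] {M : CoxeterMatrix B}
    (cs : CoxeterSystem M W) {Sp Sm : Set B} (hS : IsCompl Sp Sm)
    (hconj : ∀ i ∈ Sp, ∀ j ∈ Sm, ¬ IsConj (cs.simple i) (cs.simple j))
    (φ : B → ℤ) (hφ : Star Sp Sm φ) (i : B) :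
    epsilon cs hS hconj φ hφ (cs.simple i) = if φ i < 0 then -1 else 1 :=
  cs.lift_apply_simple _ i

/-- The module `⨁_l α_l E^{f(l)}`. -/
def sumWithMult {G : Type u} [Group G] {Λ : Type w} {X : Λ → Type v}
    [∀ l, AddCommGroup (X l)] [∀ l, Module ℂ (X l)]
    (E : ∀ l, Representation ℂ G (X l)) (α : Λ → ℕ) (f : Λ → Λ) :=
  Representation.directSum fun p : (Σ l : Λ, Fin (α l)) => E (f p.1)

end

end ConstructibleHecke

open ConstructibleHecke

/-!
The Hecke algebras for `φ` and `|φ|` are isomorphic: `T_w` is sent to `ε(w) q^{L(w)} T_w`, where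
`L(w)` is the sum of `φ(s)` over the letters `s` with `φ(s) < 0` in a reduced word of `w`. The
quadratic relation survives because multiplication by `-q^{φ(s)}` exchanges the roles of the two
eigenvalues of `T_s` (`IsSignChange.heckeHom`). Since `T_1` is sent to `T_1` and every other `T_w` to
a multiple of itself, the symmetrizing traces correspond, and hence so do the Schur elements of
corresponding simple modules; at `q^{1/2} = 1` the correspondence becomes `E ↦ E ⊗ ε`. Thus
`a^φ(E) = a^{|φ|}(E ⊗ ε)` (`HasAValue.of_twistedIso`). As tensoring with `ε` commutes with induction
and direct sums, it commutes with truncated induction (`TwistedIso.jInd`), and an induction over the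
construction gives the claim (`IsConstructible.of_twistedIso`).

The argument is carried out for a pair of weights `φ`, `ψ` related by `IsSignChange`, a condition
that is symmetric in `φ` and `ψ` and passes to parabolic subgroups. It requires `L` to be additive
over words that have no proper subword with the same product (`Irredundant`). This includes the
reduced words of every parabolic subgroup, so that lengths in `W_I` and in `W` need not be compared.
That such a function `L` exists on `W` is shown by summing weights over the inversions of `w`
(`exists_weight`): the group acts on `W × ZMod 2` in such a way that the second coordinate records
the parity of the multiplicity of a reflection in the inversion sequence of a word, so that this
parity depends on the product only, and for an irredundant word all these multiplicities are at most
one.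
-/

namespace ConstructibleHecke

/-! ### Irredundant words and weights -/

/-- A word is irredundant if no proper subword has the same product. Only the letters of
the word itself enter, so that a word in the generators of a parabolic subgroup may be viewed as a
word in all generators. -/
def Irredundant {B : Type b} {G : Type u} [Group G] (s : B → G) (l : List B) : Prop :=
  ∀ l' : List B, l'.Sublist l → (l'.map s).prod = (l.map s).prod → l' = l

section Irredundant

variable {B : Type b} {G : Type u} [Group G] {s : B → G}

theorem wordLength_prod_le (l : List B) : wordLength s (l.map s).prod ≤ l.length :=
  Nat.sInf_le ⟨l, rfl, rfl⟩

theorem exists_length_eq_wordLength {g : G} (h : ∃ l : List B, (l.map s).prod = g) :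
    ∃ l : List B, l.length = wordLength s g ∧ (l.map s).prod = g := by
  obtain ⟨l, hl⟩ := h
  exact Nat.sInf_mem (s := {n : ℕ | ∃ l : List B, l.length = n ∧ (l.map s).prod = g})
    ⟨l.length, l, rfl, hl⟩

theorem irredundant_of_length_eq_wordLength {l : List B}
    (h : l.length = wordLength s (l.map s).prod) : Irredundant s l := by
  intro l' hl' hp
  refine hl'.eq_of_length_le ?_
  rw [h, ← hp]
  exact wordLength_prod_le l'

theorem irredundant_nil : Irredundant s [] := fun _ h _ => List.sublist_nil.mp h

theorem irredundant_singleton {i : B} (h : s i ≠ 1) : Irredundant s [i] := by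
  intro l' hl' hp
  rcases List.sublist_cons_iff.mp hl' with h' | ⟨r, rfl, hr⟩
  · rw [List.sublist_nil.mp h'] at hp
    simp only [List.map_nil, List.prod_nil, List.map_cons, List.prod_cons, mul_one] at hp
    exact absurd hp.symm h
  · rw [List.sublist_nil.mp hr]

theorem coe_prod_map_parabolicGen (I : Set B) (l : List I) :
    (((l.map (parabolicGen s I)).prod : parabolic s I) : G) = ((l.map Subtype.val).map s).prod := by
  induction l with
  | nil => simp
  | cons i l ih => simp [parabolicGen]

theorem Irredundant.map_val {I : Set B} {l : List I} (h : Irredundant (parabolicGen s I) l) :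
    Irredundant s (l.map Subtype.val) := by
  intro l' hl' hp
  obtain ⟨r, hr, rfl⟩ := List.sublist_map_iff.mp hl'
  rw [h r hr (Subtype.ext ?_)]
  rwa [coe_prod_map_parabolicGen, coe_prod_map_parabolicGen]

end Irredundant

/-- The function `L` on `G` computes the total `φ`-weight of the letters with `ε = -1` in every
irredundant word. -/
def IsWeight {B : Type b} {G : Type u} [Group G] (s : B → G) (φ : B → ℤ) (ε : G →* ℤˣ)
    (L : G → ℤ) : Prop :=
  ∀ l : List B, Irredundant s l →
    L (l.map s).prod = (l.map fun i => if ε (s i) = -1 then φ i else 0).sum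

/-- The generators `s` of `G` are involutions, and `φ`, `ψ` are weights for them with `ψ = φ` on
the generators with `ε = 1` and `ψ = -φ` on those with `ε = -1`, such that the total `φ`-weight of
the letters with `ε = -1` of an irredundant word depends only on the product of the word. -/
structure IsSignChange {B : Type b} {G : Type u} [Group G] (s : B → G) (φ ψ : B → ℤ)
    (ε : G →* ℤˣ) : Prop where
  mul_self : ∀ i, s i * s i = 1
  exists_word : ∀ g, ∃ l : List B, (l.map s).prod = g
  sign : ∀ i, (ε (s i) = 1 ∧ ψ i = φ i) ∨ (ε (s i) = -1 ∧ ψ i = -φ i)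
  exists_weight : ∃ L : G → ℤ, IsWeight s φ ε L

namespace IsSignChange

variable {B : Type b} {G : Type u} [Group G] {s : B → G} {φ ψ : B → ℤ} {ε : G →* ℤˣ}

theorem isWeight_neg (h : IsSignChange s φ ψ ε) {L : G → ℤ} (hL : IsWeight s φ ε L) :
    IsWeight s ψ ε (-L) := by
  intro l hl
  rw [Pi.neg_apply, hL l hl, List.sum_neg, List.map_map]
  refine congrArg List.sum (List.map_congr_left fun i _ => ?_)
  rcases h.sign i with ⟨h1, h2⟩ | ⟨h1, h2⟩
  · have : (1 : ℤˣ) ≠ -1 := by decide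
    simp [h1, this]
  · simp [h1, h2]

theorem symm (h : IsSignChange s φ ψ ε) : IsSignChange s ψ φ ε where
  mul_self := h.mul_self
  exists_word := h.exists_word
  sign i := by
    rcases h.sign i with ⟨h1, h2⟩ | ⟨h1, h2⟩
    · exact .inl ⟨h1, h2.symm⟩
    · exact .inr ⟨h1, by rw [h2, neg_neg]⟩
  exists_weight := by
    obtain ⟨L, hL⟩ := h.exists_weight
    exact ⟨-L, h.isWeight_neg hL⟩

theorem parabolic (h : IsSignChange s φ ψ ε) (I : Set B) :
    IsSignChange (parabolicGen s I) (I.domRestrict φ) (I.domRestrict ψ)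
      (ε.comp (parabolic s I).subtype) where
  mul_self i := Subtype.ext (h.mul_self i)
  exists_word := by
    rintro ⟨g, hg⟩
    suffices H : ∃ l : List I, ((l.map Subtype.val).map s).prod = g by
      obtain ⟨l, hl⟩ := H
      exact ⟨l, Subtype.ext ((coe_prod_map_parabolicGen I l).trans hl)⟩
    induction hg using Subgroup.closure_induction with
    | mem x hx =>
      obtain ⟨i, hi, rfl⟩ := hx
      exact ⟨[⟨i, hi⟩], by simp⟩
    | one => exact ⟨[], rfl⟩
    | mul x y _ _ hx hy =>
      obtain ⟨l, rfl⟩ := hx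
      obtain ⟨l', rfl⟩ := hy
      exact ⟨l ++ l', by simp⟩
    | inv x _ hx =>
      obtain ⟨l, rfl⟩ := hx
      refine ⟨l.reverse, ?_⟩
      rw [List.prod_inv_reverse, List.map_reverse, List.map_reverse, List.map_map, List.map_map]
      congr 2
      refine List.map_congr_left fun i _ => ?_
      exact eq_inv_of_mul_eq_one_left (h.mul_self i)
  sign i := h.sign i
  exists_weight := by
    obtain ⟨L, hL⟩ := h.exists_weight
    refine ⟨fun g => L g, fun l hl => ?_⟩
    dsimp only
    rw [coe_prod_map_parabolicGen, hL _ hl.map_val, List.map_map]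
    rfl

end IsSignChange

/-! ### The reflection cocycle of a Coxeter group -/

section Coxeter

variable {B : Type b} {W : Type u} [Group W] {M : CoxeterMatrix B} (cs : CoxeterSystem M W)

open Classical in
/-- The map `(t, z) ↦ (s_i t s_i, z + [t = s_i])` on `W × ZMod 2`. -/
noncomputable def reflStep (i : B) : Function.End (W × ZMod 2) := fun p =>
  (cs.simple i * p.1 * cs.simple i, p.2 + if p.1 = cs.simple i then 1 else 0)

open Classical in
theorem reflStep_mul_pow_apply (i j : B) (k : ℕ) (t : W) (z : ZMod 2) :
    ((reflStep cs i * reflStep cs j) ^ k) (t, z) =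
      ((cs.simple i * cs.simple j) ^ k * t * ((cs.simple i * cs.simple j) ^ k)⁻¹,
        z + ∑ y ∈ Finset.range (2 * k),
          if t = cs.simple j * (cs.simple i * cs.simple j) ^ y then 1 else 0) := by
  induction k with
  | zero =>
    simp only [pow_zero, one_mul, inv_one, mul_one, mul_zero, Finset.range_zero, Finset.sum_empty,
      add_zero]
    rfl
  | succ k ih =>
    rw [pow_succ']
    change (reflStep cs i) ((reflStep cs j) (((reflStep cs i * reflStep cs j) ^ k) (t, z))) = _
    rw [ih]
    set r := cs.simple i * cs.simple j with hr
    have hj : ∀ n : ℕ, cs.simple j * r ^ n = (r ^ n)⁻¹ * cs.simple j := by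
      intro n
      have h1 : SemiconjBy (cs.simple j) r r⁻¹ := by simp [SemiconjBy, hr, mul_assoc]
      simpa using (h1.pow_right n).eq
    have e1 : r ^ k * t * (r ^ k)⁻¹ = cs.simple j ↔ t = cs.simple j * r ^ (2 * k) := by
      rw [mul_inv_eq_iff_eq_mul, ← eq_inv_mul_iff_mul_eq, two_mul, pow_add, ← mul_assoc,
        ← mul_assoc, hj k]
    have e2 : cs.simple j * (r ^ k * t * (r ^ k)⁻¹) * cs.simple j = cs.simple i ↔
        t = cs.simple j * r ^ (2 * k + 1) := by
      have h1 : cs.simple j * (r ^ k * t * (r ^ k)⁻¹) * cs.simple j = cs.simple i ↔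
          r ^ k * t * (r ^ k)⁻¹ = cs.simple j * r := by
        rw [← mul_right_inj (cs.simple j), ← mul_left_inj (cs.simple j), hr]
        simp only [mul_assoc, cs.simple_mul_simple_cancel_left, cs.simple_mul_simple_self, mul_one]
      have h2 : (r ^ k)⁻¹ * (cs.simple j * r * r ^ k) = cs.simple j * r ^ (2 * k + 1) := by
        rw [mul_assoc (cs.simple j), ← mul_assoc, ← hj k, mul_assoc, ← pow_succ', ← pow_add]
        congr 2
        ring
      rw [h1, mul_inv_eq_iff_eq_mul, ← eq_inv_mul_iff_mul_eq, h2]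
    refine Prod.ext ?_ ?_
    · simp [reflStep, pow_succ', hr, mul_assoc]
    · rw [show 2 * (k + 1) = 2 * k + 1 + 1 by ring, Finset.sum_range_succ, Finset.sum_range_succ]
      simp only [reflStep, e1, e2]
      ring

theorem reflStep_mul_pow_eq_one {i j : B} {k : ℕ} (h : (cs.simple i * cs.simple j) ^ k = 1) :
    (reflStep cs i * reflStep cs j) ^ k = 1 := by
  classical
  funext ⟨t, z⟩
  -- each reflection of the dihedral subgroup is counted twice
  have h0 : ∑ y ∈ Finset.range (2 * k),
      (if t = cs.simple j * (cs.simple i * cs.simple j) ^ y then 1 else 0 : ZMod 2) = 0 := by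
    have h2 : ∀ y, (cs.simple i * cs.simple j) ^ (k + y) = (cs.simple i * cs.simple j) ^ y :=
      fun y => by rw [pow_add, h, one_mul]
    rw [two_mul, Finset.sum_range_add]
    simp only [h2]
    exact CharTwo.add_self_eq_zero _
  refine (reflStep_mul_pow_apply cs i j k t z).trans (Prod.ext ?_ ?_)
  · change _ = t
    simp [h]
  · change z + _ = z
    rw [add_eq_left]
    exact h0

theorem isLiftable_reflStep : M.IsLiftable (reflStep cs) := fun i j =>
  reflStep_mul_pow_eq_one cs (cs.simple_mul_simple_pow i j)

/-- The action of the group on `W × ZMod 2` in which `s_i` acts by `reflStep`. -/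
noncomputable def reflHom : W →* Function.End (W × ZMod 2) :=
  cs.lift ⟨reflStep cs, isLiftable_reflStep cs⟩

open Classical in
theorem reflHom_wordProd_apply (ω : List B) (t : W) (z : ZMod 2) :
    reflHom cs (cs.wordProd ω) (t, z) =
      (cs.wordProd ω * t * (cs.wordProd ω)⁻¹, z + (cs.rightInvSeq ω).count t) := by
  induction ω with
  | nil =>
    simp only [cs.wordProd_nil, map_one, one_mul, inv_one, mul_one, CoxeterSystem.rightInvSeq_nil,
      List.count_nil, Nat.cast_zero, add_zero]
    rfl
  | cons i ω ih =>
    rw [cs.wordProd_cons, map_mul]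
    change reflHom cs (cs.simple i) (reflHom cs (cs.wordProd ω) (t, z)) = _
    rw [ih, reflHom, cs.lift_apply_simple]
    have e : cs.wordProd ω * t * (cs.wordProd ω)⁻¹ = cs.simple i ↔
        (cs.wordProd ω)⁻¹ * cs.simple i * cs.wordProd ω = t := by
      rw [mul_inv_eq_iff_eq_mul, ← eq_inv_mul_iff_mul_eq, mul_assoc, eq_comm]
    refine Prod.ext ?_ ?_
    · simp [reflStep, mul_assoc]
    · simp only [reflStep, CoxeterSystem.rightInvSeq, List.count_cons, e, beq_iff_eq]
      push_cast
      ring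

open Classical in
/-- The reflections that occur an odd number of times in the inversion sequence of a word depend
only on its product `w`; this is the indicator function of the set of these reflections. -/
noncomputable def reflParity (w t : W) : ZMod 2 :=
  (reflHom cs w (t, 0)).2

open Classical in
theorem reflParity_wordProd (ω : List B) (t : W) :
    reflParity cs (cs.wordProd ω) t = (cs.rightInvSeq ω).count t := by
  rw [reflParity, reflHom_wordProd_apply, zero_add]

/-- A repetition in the inversion sequence allows to delete two letters of the word. -/
theorem nodup_rightInvSeq_of_irredundant {ω : List B} (h : Irredundant cs.simple ω) :
    (cs.rightInvSeq ω).Nodup := by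
  apply List.nodup_iff_getElem?_ne_getElem?.mpr
  intro j j' hjj' hj' dup
  replace hj' : j' < ω.length := by simpa using hj'
  rw [List.getElem?_eq_getElem (by simp; lia), List.getElem?_eq_getElem (by simp; lia)] at dup
  apply Option.some_injective at dup
  rw [← List.getD_eq_getElem _ 1, ← List.getD_eq_getElem _ 1] at dup
  have h3 : (cs.rightInvSeq (ω.eraseIdx j)).getD (j' - 1) 1 = (cs.rightInvSeq ω).getD j' 1 := by
    grind only [cs.getD_rightInvSeq, = List.eraseIdx_eq_take_drop_succ, = List.getElem?_eraseIdx,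
      = List.drop_append, List.drop_of_length_le, List.drop_drop, = List.length_append,
      = List.length_take, = List.length_drop, = min_def]
  have h5 : cs.wordProd ((ω.eraseIdx j).eraseIdx (j' - 1)) = cs.wordProd ω := by
    rw [← cs.wordProd_mul_getD_rightInvSeq, h3, ← cs.wordProd_mul_getD_rightInvSeq, ← dup,
      mul_assoc, cs.getD_rightInvSeq_mul_self, mul_one]
  have h6 := congrArg List.length (h _ ((List.eraseIdx_sublist _ _).trans
    (List.eraseIdx_sublist _ _)) h5)
  grind

theorem sum_map_rightInvSeq {c : B → ℤ} {d : W → ℤ}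
    (hd : ∀ i t, IsConj (cs.simple i) t → d t = c i) (ω : List B) :
    ((cs.rightInvSeq ω).map d).sum = (ω.map c).sum := by
  induction ω with
  | nil => rfl
  | cons i ω ih =>
    simp only [CoxeterSystem.rightInvSeq, List.map_cons, List.sum_cons, ih]
    rw [hd i]
    exact isConj_iff.mpr ⟨(cs.wordProd ω)⁻¹, by simp⟩

/-- In a finite Coxeter group, a weight that takes equal values on conjugate generators extends to
a function on the group: sum it over the inversions of an element. -/
theorem exists_weight [Finite W] (c : B → ℤ)
    (hc : ∀ i j, IsConj (cs.simple i) (cs.simple j) → c i = c j) :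
    ∃ L : W → ℤ, ∀ l : List B, Irredundant cs.simple l →
      L (l.map cs.simple).prod = (l.map c).sum := by
  classical
  have := Fintype.ofFinite W
  let d : W → ℤ := fun t => if h : ∃ i, IsConj (cs.simple i) t then c h.choose else 0
  have hd : ∀ i t, IsConj (cs.simple i) t → d t = c i := by
    intro i t hit
    have h : ∃ i, IsConj (cs.simple i) t := ⟨i, hit⟩
    simp only [d, dif_pos h]
    exact hc _ _ (h.choose_spec.trans hit.symm)
  refine ⟨fun w => ∑ t with reflParity cs w t = 1, d t, fun l hl => ?_⟩
  have hn := nodup_rightInvSeq_of_irredundant cs hl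
  change ∑ t with reflParity cs (cs.wordProd l) t = 1, d t = _
  rw [← sum_map_rightInvSeq cs hd, ← List.sum_toFinset _ hn]
  refine Finset.sum_congr (Finset.ext fun t => ?_) fun _ _ => rfl
  rw [Finset.mem_filter, reflParity_wordProd, List.mem_toFinset, hn.count]
  by_cases ht : t ∈ cs.rightInvSeq l <;> simp [ht]

end Coxeter

theorem isSignChange_abs {B : Type b} {W : Type u} [Group W] [Finite W] {M : CoxeterMatrix B}
    (cs : CoxeterSystem M W) {Sp Sm : Set B} (hS : IsCompl Sp Sm)
    (hconj : ∀ i ∈ Sp, ∀ j ∈ Sm, ¬ IsConj (cs.simple i) (cs.simple j))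
    (φ : B → ℤ) (hφ : Star Sp Sm φ) :
    IsSignChange cs.simple φ (fun i => |φ i|) (epsilon cs hS hconj φ hφ) where
  mul_self := cs.simple_mul_simple_self
  exists_word g := by
    obtain ⟨l, hl⟩ := cs.wordProd_surjective g
    exact ⟨l, hl⟩
  sign i := by
    rw [epsilon_simple]
    split_ifs with h
    · exact .inr ⟨rfl, abs_of_neg h⟩
    · exact .inl ⟨rfl, abs_of_nonneg (not_lt.mp h)⟩
  exists_weight := by
    refine exists_weight cs _ fun i j hij => ?_
    rw [epsilon_simple, epsilon_simple, hφ.eq_of_isConj cs hS hconj hij]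

/-! ### Isomorphisms of Hecke algebras given by sign changes -/

section Hecke

variable {B : Type b} {G : Type u} [Group G] {s : B → G} {φ ψ : B → ℤ} {ε : G →* ℤˣ}

theorem qpow_add (m n : ℤ) : qpow (m + n) = qpow m * qpow n := by
  rw [qpow, qpow, qpow, ← LaurentPolynomial.T_add, mul_add]

theorem qpow_zero : qpow 0 = 1 := by simp [qpow]

theorem qpow_mul_neg (n : ℤ) : qpow n * qpow (-n) = 1 := by
  rw [← qpow_add, add_neg_cancel, qpow_zero]

theorem specOne_qpow (n : ℤ) : specOne (qpow n) = 1 := by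
  simp [specOne, qpow]

/-- The unit `ε(g) q^{L(g)}` of `A`. -/
noncomputable def twistScalar (ε : G →* ℤˣ) (L : G → ℤ) (g : G) : A :=
  ((ε g : ℤ) : A) * qpow (L g)

theorem twistScalar_mul {ε : G →* ℤˣ} {L L' : G → ℤ} (h : L' = -L) (g : G) :
    twistScalar ε L g * twistScalar ε L' g = 1 := by
  rw [twistScalar, twistScalar, mul_mul_mul_comm, h, Pi.neg_apply, qpow_mul_neg, mul_one,
    ← Int.cast_mul, ← Units.val_mul, Int.units_mul_self, Units.val_one, Int.cast_one]

theorem specOne_twistScalar (ε : G →* ℤˣ) (L : G → ℤ) (g : G) :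
    specOne (twistScalar ε L g) = ((ε g : ℤ) : ℂ) := by
  rw [twistScalar, map_mul, specOne_qpow, mul_one, map_intCast]

/-- The element `T_g` of the Hecke algebra over `A`. -/
noncomputable def heckeGen (s : B → G) (φ : B → ℤ) (g : G) : HeckeAlgebra s φ :=
  RingQuot.mkAlgHom A (HeckeRel s φ) (FreeAlgebra.ι A g)

theorem heckeGen_one : heckeGen s φ 1 = 1 := by
  rw [heckeGen, RingQuot.mkAlgHom_rel A HeckeRel.one, map_one]

theorem heckeGen_mul {x y : G} (h : wordLength s (x * y) = wordLength s x + wordLength s y) :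
    heckeGen s φ x * heckeGen s φ y = heckeGen s φ (x * y) := by
  rw [heckeGen, heckeGen, ← map_mul, RingQuot.mkAlgHom_rel A (HeckeRel.mul x y h), heckeGen]

theorem heckeGen_quad (i : B) :
    (heckeGen s φ (s i) - algebraMap A _ (qpow (φ i))) * (heckeGen s φ (s i) + 1) = 0 := by
  have := RingQuot.mkAlgHom_rel A (HeckeRel.quad (s := s) (φ := φ) i)
  rwa [map_mul, map_sub, map_add, map_one, map_zero, AlgHom.commutes] at this

namespace IsSignChange

theorem weight_one {L : G → ℤ} (hL : IsWeight s φ ε L) : L 1 = 0 :=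
  hL [] irredundant_nil

theorem weight_mul (h : IsSignChange s φ ψ ε) {L : G → ℤ} (hL : IsWeight s φ ε L) {x y : G}
    (hxy : wordLength s (x * y) = wordLength s x + wordLength s y) : L (x * y) = L x + L y := by
  obtain ⟨l, hl, rfl⟩ := exists_length_eq_wordLength (h.exists_word x)
  obtain ⟨l', hl', rfl⟩ := exists_length_eq_wordLength (h.exists_word y)
  rw [hL l (irredundant_of_length_eq_wordLength hl),
    hL l' (irredundant_of_length_eq_wordLength hl'), ← List.prod_append, ← List.map_append,
    hL (l ++ l') (irredundant_of_length_eq_wordLength ?_), List.map_append, List.sum_append]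
  rw [List.map_append, List.prod_append, hxy, List.length_append, hl, hl']

theorem weight_gen {L : G → ℤ} (hL : IsWeight s φ ε L) (i : B) :
    L (s i) = if ε (s i) = -1 then φ i else 0 := by
  by_cases h1 : s i = 1
  · have h2 : (1 : ℤˣ) ≠ -1 := by decide
    rw [h1, map_one, weight_one hL, if_neg h2]
  · simpa using hL [i] (irredundant_singleton h1)

theorem quadratic_of_neg {R : Type*} [Ring R] {T a a' c : R} (hc : c + a = 0) (ha : a * a' = 1)
    (haT : a * T = T * a) (haT' : a' * T = T * a') (h : (T - a') * (T + 1) = 0) :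
    (c * T - a) * (c * T + 1) = 0 := by
  obtain rfl : c = -a := eq_neg_of_add_eq_zero_left hc
  have e1 : -a * T - a = -(a * (T + 1)) := by noncomm_ring
  have e2 : -a * T + 1 = -(a * (T - a')) := by rw [mul_sub, ha]; noncomm_ring
  have e3 : (T + 1) * a = a * (T + 1) := by rw [add_mul, ← haT, one_mul, mul_add, mul_one]
  have e4 : (T + 1) * (T - a') = 0 := by
    rw [← h]
    simp only [add_mul, mul_sub, sub_mul, mul_add, one_mul, mul_one, haT']
    abel
  rw [e1, e2, neg_mul_neg, mul_assoc, ← mul_assoc (T + 1), e3, mul_assoc, e4, mul_zero, mul_zero]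

/-- The homomorphism `T_g ↦ ε(g) q^{L(g)} T_g`. For a generator with `ε(s) = -1` the quadratic
relation is preserved because the eigenvalues `q^{φ(s)}`, `-1` of `T_s` in the source
are the eigenvalues `-1`, `q^{-φ(s)}` of `T_s` in the target multiplied by `-q^{φ(s)}`. -/
noncomputable def heckeHom (h : IsSignChange s φ ψ ε) {L : G → ℤ} (hL : IsWeight s φ ε L) :
    HeckeAlgebra s φ →ₐ[A] HeckeAlgebra s ψ :=
  RingQuot.liftAlgHom A ⟨FreeAlgebra.lift A fun g => twistScalar ε L g • heckeGen s ψ g, by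
    intro x y hxy
    induction hxy with
    | one =>
      rw [FreeAlgebra.lift_ι_apply, map_one, heckeGen_one, twistScalar, weight_one hL]
      simp [qpow_zero]
    | mul x y hxy =>
      rw [map_mul, FreeAlgebra.lift_ι_apply, FreeAlgebra.lift_ι_apply, FreeAlgebra.lift_ι_apply,
        smul_mul_smul_comm, heckeGen_mul hxy, twistScalar, twistScalar, twistScalar,
        h.weight_mul hL hxy, qpow_add, map_mul, Units.val_mul, Int.cast_mul, mul_mul_mul_comm]
    | quad i =>
      rw [map_mul, map_sub, map_add, map_one, map_zero, AlgHom.commutes, FreeAlgebra.lift_ι_apply]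
      have hq := heckeGen_quad (s := s) (φ := ψ) i
      rcases h.sign i with ⟨h1, h2⟩ | ⟨h1, h2⟩
      · have h3 : (1 : ℤˣ) ≠ -1 := by decide
        rw [twistScalar, weight_gen hL, h1, if_neg h3, qpow_zero]
        simpa [h2] using hq
      · rw [twistScalar, weight_gen hL, h1, if_pos rfl]
        rw [h2] at hq
        rw [Algebra.smul_def]
        refine quadratic_of_neg (R := HeckeAlgebra s ψ)
          (a' := algebraMap A (HeckeAlgebra s ψ) (qpow (-φ i))) ?_ ?_
          (Algebra.commutes _ _) (Algebra.commutes _ _) hq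
        · rw [← map_add, Units.val_neg, Units.val_one, Int.cast_neg, Int.cast_one, neg_one_mul,
            neg_add_cancel, map_zero]
        · rw [← map_mul, qpow_mul_neg, map_one]⟩

theorem heckeHom_heckeGen (h : IsSignChange s φ ψ ε) {L : G → ℤ} (hL : IsWeight s φ ε L) (g : G) :
    h.heckeHom hL (heckeGen s φ g) = twistScalar ε L g • heckeGen s ψ g := by
  rw [heckeHom, heckeGen, RingQuot.liftAlgHom_mkAlgHom_apply, FreeAlgebra.lift_ι_apply]

theorem heckeHom_comp (h : IsSignChange s φ ψ ε) {L L' : G → ℤ} (hL : IsWeight s φ ε L)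
    (h' : IsSignChange s ψ φ ε) (hL' : IsWeight s ψ ε L') (hLL' : L' = -L) :
    (h'.heckeHom hL').comp (h.heckeHom hL) = AlgHom.id A _ := by
  refine RingQuot.ringQuot_ext' _ _ _ (FreeAlgebra.hom_ext (funext fun g => ?_))
  change h'.heckeHom hL' (h.heckeHom hL (heckeGen s φ g)) = heckeGen s φ g
  rw [heckeHom_heckeGen, map_smul, heckeHom_heckeGen, smul_smul, twistScalar_mul hLL', one_smul]

/-- The isomorphism `T_g ↦ ε(g) q^{L(g)} T_g` over `K`. -/
noncomputable def heckeEquiv (h : IsSignChange s φ ψ ε) {L : G → ℤ} (hL : IsWeight s φ ε L) :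
    HeckeAlgebraK s φ ≃ₐ[K] HeckeAlgebraK s ψ :=
  Algebra.TensorProduct.congr AlgEquiv.refl
    (AlgEquiv.ofAlgHom (h.heckeHom hL) (h.symm.heckeHom (h.isWeight_neg hL))
      (h.symm.heckeHom_comp (h.isWeight_neg hL) h hL (neg_neg L).symm)
      (h.heckeHom_comp hL h.symm (h.isWeight_neg hL) rfl))

theorem heckeEquiv_heckeT (h : IsSignChange s φ ψ ε) {L : G → ℤ} (hL : IsWeight s φ ε L) (g : G) :
    h.heckeEquiv hL (heckeT s φ g) = algebraMap A K (twistScalar ε L g) • heckeT s ψ g := by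
  change (1 : K) ⊗ₜ[A] h.heckeHom hL (heckeGen s φ g) = _
  rw [heckeHom_heckeGen, TensorProduct.tmul_smul, ← algebraMap_smul K]
  rfl

end IsSignChange

namespace HeckeRep

/-- The pullback of a representation along an isomorphism of Hecke algebras. -/
noncomputable def pull (f : HeckeAlgebraK s ψ ≃ₐ[K] HeckeAlgebraK s φ) (V : HeckeRep s φ) :
    HeckeRep s ψ where
  dim := V.dim
  toAlgHom := V.toAlgHom.comp f.toAlgHom

variable (f : HeckeAlgebraK s ψ ≃ₐ[K] HeckeAlgebraK s φ)

theorem IsSimple.pull {V : HeckeRep s φ} (hV : V.IsSimple) : (V.pull f).IsSimple := by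
  refine ⟨hV.1, fun p hp => hV.2 p fun h x hx => ?_⟩
  have := hp (f.symm h) x hx
  change (V.toAlgHom (f (f.symm h))).mulVec x ∈ p at this
  rwa [f.apply_symm_apply] at this

theorem IsIso.pull {V V' : HeckeRep s φ} (h : V.IsIso V') : (V.pull f).IsIso (V'.pull f) := by
  obtain ⟨e, he⟩ := h
  exact ⟨e, fun h x => he (f h) x⟩

theorem pull_pull_symm (V : HeckeRep s ψ) : (V.pull f.symm).pull f = V := by
  cases V with
  | mk d F => exact congrArg (HeckeRep.mk d) (AlgHom.ext fun x =>
      congrArg F (f.symm_apply_apply x))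

theorem pull_symm_pull (V : HeckeRep s φ) : (V.pull f).pull f.symm = V :=
  pull_pull_symm f.symm V

theorem IsCompleteList.pull {n : ℕ} {V : Fin n → HeckeRep s φ} (h : IsCompleteList V) :
    IsCompleteList fun i => (V i).pull f := by
  refine ⟨fun i => (h.1 i).pull f, fun i j hij => h.2.1 i j ?_, fun U hU => ?_⟩
  · simpa only [pull_symm_pull] using hij.pull f.symm
  · obtain ⟨i, hi⟩ := h.2.2 _ (hU.pull f.symm)
    exact ⟨i, by simpa only [pull_pull_symm] using hi.pull f⟩

theorem traceT_pull {u : G → A} (hf : ∀ g, f (heckeT s ψ g) = algebraMap A K (u g) • heckeT s φ g)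
    (V : HeckeRep s φ) (g : G) : (V.pull f).traceT g = algebraMap A K (u g) * V.traceT g := by
  change (V.toAlgHom (f (heckeT s ψ g))).trace = _
  rw [hf, map_smul, Matrix.trace_smul, smul_eq_mul, traceT]

/-- The Schur elements do not change, since `f` is compatible with the symmetrizing traces. -/
theorem IsSchurElement.pull {u : G → A} (hu : u 1 = 1)
    (hf : ∀ g, f (heckeT s ψ g) = algebraMap A K (u g) • heckeT s φ g)
    {V : HeckeRep s φ} {c : K} (h : V.IsSchurElement c) : (V.pull f).IsSchurElement c := by
  obtain ⟨n, U, d, hU, hd, hτ, i, hi, rfl⟩ := h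
  refine ⟨n, fun i => (U i).pull f, d, hU.pull f, hd, fun g => ?_, i, hi.pull f, rfl⟩
  rw [Finset.sum_congr rfl fun i _ => by rw [traceT_pull f hf, mul_left_comm], ← Finset.mul_sum,
    hτ]
  split_ifs with hg
  · rw [hg, hu, map_one, mul_one]
  · rw [mul_zero]

end HeckeRep

end Hecke

/-! ### Representations that are isomorphic up to a linear character -/

/-- The representation `ρ` is isomorphic to `ρ' ⊗ ε`. -/
def TwistedIso {G : Type u} [Group G] (ε : G →* ℤˣ) {X : Type*} [AddCommGroup X] [Module ℂ X]
    {X' : Type*} [AddCommGroup X'] [Module ℂ X'] (ρ : Representation ℂ G X)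
    (ρ' : Representation ℂ G X') : Prop :=
  ∃ e : X ≃ₗ[ℂ] X', ∀ g x, e (ρ g x) = ((ε g : ℤ) : ℂ) • ρ' g (e x)

section TwistedIso

variable {G : Type u} [Group G] {ε δ : G →* ℤˣ}
  {X : Type*} [AddCommGroup X] [Module ℂ X] {ρ : Representation ℂ G X}
  {X' : Type*} [AddCommGroup X'] [Module ℂ X'] {ρ' : Representation ℂ G X'}
  {X'' : Type*} [AddCommGroup X''] [Module ℂ X''] {ρ'' : Representation ℂ G X''}

theorem sign_mul_self (ε : G →* ℤˣ) (g : G) : ((ε g : ℤ) : ℂ) * ((ε g : ℤ) : ℂ) = 1 := by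
  rw [← Int.cast_mul, ← Units.val_mul, Int.units_mul_self, Units.val_one, Int.cast_one]

theorem signChar_mul_self (ε : G →* ℤˣ) : ε * ε = 1 :=
  MonoidHom.ext fun g => Int.units_mul_self (ε g)

theorem twistedIso_symm_apply {e : X ≃ₗ[ℂ] X'}
    (he : ∀ g x, e (ρ g x) = ((ε g : ℤ) : ℂ) • ρ' g (e x)) (g : G) (x : X') :
    e.symm (ρ' g x) = ((ε g : ℤ) : ℂ) • ρ g (e.symm x) := by
  rw [LinearEquiv.symm_apply_eq, map_smul, he, smul_smul, sign_mul_self, one_smul,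
    e.apply_symm_apply]

theorem TwistedIso.symm (h : TwistedIso ε ρ ρ') : TwistedIso ε ρ' ρ := by
  obtain ⟨e, he⟩ := h
  exact ⟨e.symm, twistedIso_symm_apply he⟩

theorem TwistedIso.trans (h : TwistedIso ε ρ ρ') (h' : TwistedIso δ ρ' ρ'') :
    TwistedIso (ε * δ) ρ ρ'' := by
  obtain ⟨e, he⟩ := h
  obtain ⟨f, hf⟩ := h'
  refine ⟨e.trans f, fun g x => ?_⟩
  simp [he, hf, smul_smul]

theorem twistedIso_one_iff : TwistedIso 1 ρ ρ' ↔ Nonempty (ρ.Equiv ρ') := by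
  constructor
  · rintro ⟨e, he⟩
    exact ⟨.mk e fun g => LinearMap.ext fun x => by simpa using he g x⟩
  · rintro ⟨e⟩
    exact ⟨e.toLinearEquiv, fun g x => by
      simpa using LinearMap.congr_fun (e.isIntertwining' g) x⟩

theorem twistedIso_twist (ε : G →* ℤˣ) (ρ : Representation ℂ G X) :
    TwistedIso ε ρ (twist ε ρ) :=
  ⟨.refl ℂ X, fun g x => by
    change ρ g x = ((ε g : ℤ) : ℂ) • ((ε g : ℤ) : ℂ) • ρ g x
    rw [smul_smul, sign_mul_self, one_smul]⟩

theorem TwistedIso.character_eq (h : TwistedIso ε ρ ρ') (g : G) :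
    ρ'.character g = ((ε g : ℤ) : ℂ) * ρ.character g := by
  obtain ⟨e, he⟩ := h.symm
  have : ρ' g = ((ε g : ℤ) : ℂ) • e.symm.conj (ρ g) := by
    ext x
    simp [LinearEquiv.conj_apply, ← map_smul, ← he]
  rw [Representation.character, this, map_smul, LinearMap.trace_conj', smul_eq_mul,
    Representation.character]

theorem TwistedIso.directSum {ι : Type*} {Y Y' : ι → Type*} [∀ i, AddCommGroup (Y i)]
    [∀ i, Module ℂ (Y i)] [∀ i, AddCommGroup (Y' i)] [∀ i, Module ℂ (Y' i)]
    {σ : ∀ i, Representation ℂ G (Y i)} {σ' : ∀ i, Representation ℂ G (Y' i)}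
    (h : ∀ i, TwistedIso ε (σ i) (σ' i)) :
    TwistedIso ε (Representation.directSum σ) (Representation.directSum σ') := by
  choose e he using h
  refine ⟨DFinsupp.mapRange.linearEquiv e, fun g x => DFinsupp.ext fun i => ?_⟩
  exact he i g (x i)

section ind

open Representation

/-- The automorphism `h ↦ ε(h) h` of the group algebra. -/
noncomputable def signTwist (ε : G →* ℤˣ) : MonoidAlgebra ℂ G →ₗ[ℂ] MonoidAlgebra ℂ G :=
  (MonoidAlgebra.lift ℂ (MonoidAlgebra ℂ G) G
    { toFun := fun g => MonoidAlgebra.single g ((ε g : ℤ) : ℂ)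
      map_one' := by simp [MonoidAlgebra.one_def]
      map_mul' := fun g h => by simp }).toLinearMap

theorem signTwist_single (ε : G →* ℤˣ) (g : G) :
    signTwist ε (MonoidAlgebra.single g 1) = ((ε g : ℤ) : ℂ) • MonoidAlgebra.single g (1 : ℂ) := by
  simp [signTwist]

variable {H : Type*} [Group H] (φ : H →* G) {Y : Type*} [AddCommGroup Y] [Module ℂ Y]
  {Y' : Type*} [AddCommGroup Y'] [Module ℂ Y']
  {σ : Representation ℂ H Y} {σ' : Representation ℂ H Y'}

/-- The map `h ⊗ y ↦ ε(h) h ⊗ e y` of induced modules. -/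
noncomputable def indTwistMap (e : Y →ₗ[ℂ] Y')
    (he : ∀ g y, e (σ g y) = ((ε (φ g) : ℤ) : ℂ) • σ' g (e y)) : IndV φ σ →ₗ[ℂ] IndV φ σ' :=
  Coinvariants.lift _ (Coinvariants.mk _ ∘ₗ TensorProduct.map (signTwist ε) e) fun g => by
    refine TensorProduct.ext (MonoidAlgebra.lhom_ext' fun h => LinearMap.ext_ring <|
      LinearMap.ext fun y => ?_)
    have := Coinvariants.mk_self_apply (Representation.tprod ((leftRegular ℂ G).comp φ) σ') g
      (MonoidAlgebra.single h ((ε h : ℤ) : ℂ) ⊗ₜ e y)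
    simpa [signTwist_single, he, TensorProduct.smul_tmul', TensorProduct.tmul_smul, ← mul_assoc,
      sign_mul_self] using this

theorem indTwistMap_mk (e : Y →ₗ[ℂ] Y')
    (he : ∀ g y, e (σ g y) = ((ε (φ g) : ℤ) : ℂ) • σ' g (e y)) (h : G) (y : Y) :
    indTwistMap φ e he (IndV.mk φ σ h y) = ((ε h : ℤ) : ℂ) • IndV.mk φ σ' h (e y) := by
  change Coinvariants.mk _ (signTwist ε (MonoidAlgebra.single h 1) ⊗ₜ e y) = _
  rw [signTwist_single, ← TensorProduct.smul_tmul', map_smul]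
  rfl

theorem TwistedIso.ind (h : TwistedIso (ε.comp φ) σ σ') :
    TwistedIso ε (ind φ σ) (ind φ σ') := by
  obtain ⟨e, he⟩ := h
  have he' := twistedIso_symm_apply he
  refine ⟨.ofLinearMap (indTwistMap φ e.toLinearMap he) (indTwistMap φ e.symm.toLinearMap he')
    ?_ ?_, fun g x => ?_⟩
  · refine IndV.hom_ext _ _ fun h => LinearMap.ext fun y => ?_
    change indTwistMap φ e.toLinearMap he
      (indTwistMap φ e.symm.toLinearMap he' (IndV.mk φ σ' h y)) = IndV.mk φ σ' h y
    rw [indTwistMap_mk, map_smul, indTwistMap_mk, smul_smul, sign_mul_self, one_smul]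
    exact congrArg _ (e.apply_symm_apply y)
  · refine IndV.hom_ext _ _ fun h => LinearMap.ext fun y => ?_
    change indTwistMap φ e.symm.toLinearMap he' (indTwistMap φ e.toLinearMap he (IndV.mk φ σ h y)) =
      IndV.mk φ σ h y
    rw [indTwistMap_mk, map_smul, indTwistMap_mk, smul_smul, sign_mul_self, one_smul]
    exact congrArg _ (e.symm_apply_apply y)
  · have : indTwistMap φ e.toLinearMap he ∘ₗ Representation.ind φ σ g =
        ((ε g : ℤ) : ℂ) • (Representation.ind φ σ' g ∘ₗ indTwistMap φ e.toLinearMap he) := by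
      refine IndV.hom_ext _ _ fun h => LinearMap.ext fun y => ?_
      change indTwistMap φ e.toLinearMap he (Representation.ind φ σ g (IndV.mk φ σ h y)) =
        ((ε g : ℤ) : ℂ) • Representation.ind φ σ' g (indTwistMap φ e.toLinearMap he
          (IndV.mk φ σ h y))
      rw [ind_mk, indTwistMap_mk, indTwistMap_mk, map_smul, ind_mk, smul_smul, map_mul, map_inv,
        Int.units_inv_eq_self, Units.val_mul, Int.cast_mul, mul_comm]
    exact LinearMap.congr_fun this x

end ind

end TwistedIso

/-! ### Sign changes and the `a`-function -/

section HasAValue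

variable {B : Type b} {G : Type u} [Group G] {s : B → G} {φ ψ : B → ℤ} {ε : G →* ℤˣ}
  {X : Type*} [AddCommGroup X] [Module ℂ X] {ρ : Representation ℂ G X}
  {X' : Type*} [AddCommGroup X'] [Module ℂ X'] {ρ' : Representation ℂ G X'}

/-- The `a`-value of `E` with respect to `φ` is the `a`-value of `E ⊗ ε` with respect to `ψ`:
the simple modules of the two Hecke algebras correspond to each other with equal Schur elements. -/
theorem HasAValue.of_twistedIso (h : IsSignChange s φ ψ ε) (hρ : TwistedIso ε ρ ρ') {n : ℕ}
    (hn : HasAValue s φ ρ n) : HasAValue s ψ ρ' n := by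
  obtain ⟨V, hV, hspec, c, hc, hpos, hlow⟩ := hn
  obtain ⟨L, hL⟩ := h.exists_weight
  have hL' := h.isWeight_neg hL
  have hf := h.symm.heckeEquiv_heckeT hL'
  refine ⟨V.pull (h.symm.heckeEquiv hL'), hV.pull _, fun g => ?_, c,
    hc.pull _ ?_ hf, hpos, hlow⟩
  · obtain ⟨a, ha, ha'⟩ := hspec g
    refine ⟨twistScalar ε (-L) g * a, ?_, ?_⟩
    · rw [map_mul, HeckeRep.traceT_pull _ hf, ha]
    · rw [map_mul, specOne_twistScalar, ha', hρ.character_eq]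
  · rw [twistScalar, IsSignChange.weight_one hL', map_one, qpow_zero, Units.val_one, Int.cast_one,
      mul_one]

end HasAValue

/-! ### Truncated induction -/

section Truncation

variable {B : Type b} {G : Type u} [Group G] {s : B → G} {φ ψ : B → ℤ} {ε : G →* ℤˣ}
  {X : Type*} [AddCommGroup X] [Module ℂ X] {ρ : Representation ℂ G X}
  {X' : Type*} [AddCommGroup X'] [Module ℂ X'] {ρ' : Representation ℂ G X'}

theorem sign_smul_mem_iff {ε : G →* ℤˣ} {g : G} {p : Submodule ℂ X} {x : X} :
    ((ε g : ℤ) : ℂ) • x ∈ p ↔ x ∈ p := by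
  rcases Int.units_eq_one_or (ε g) with h | h <;> simp [h]

/-- The image of a subrepresentation under an isomorphism up to a linear character. -/
def mapSubrep (e : X ≃ₗ[ℂ] X')
    (he : ∀ g x, e (ρ g x) = ((ε g : ℤ) : ℂ) • ρ' g (e x)) (p : Subrepresentation ρ) :
    Subrepresentation ρ' where
  toSubmodule := p.toSubmodule.map e.toLinearMap
  apply_mem_toSubmodule g x hx := by
    obtain ⟨y, hy, rfl⟩ := hx
    have := Submodule.mem_map_of_mem (f := e.toLinearMap) (p.apply_mem_toSubmodule g hy)
    rwa [LinearEquiv.coe_coe, he, sign_smul_mem_iff] at this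

theorem twistedIso_mapSubrep (e : X ≃ₗ[ℂ] X')
    (he : ∀ g x, e (ρ g x) = ((ε g : ℤ) : ℂ) • ρ' g (e x)) (p : Subrepresentation ρ) :
    TwistedIso ε p.toRepresentation (mapSubrep e he p).toRepresentation :=
  ⟨e.submoduleMap p.toSubmodule, fun g x => Subtype.ext (he g x)⟩

theorem TwistedIso.isIrreducible (h : TwistedIso ε ρ ρ') (hρ : ρ.IsIrreducible) :
    ρ'.IsIrreducible := by
  obtain ⟨e, he⟩ := h
  have hs := twistedIso_symm_apply he
  let o : Subrepresentation ρ' ≃o Subrepresentation ρ :=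
    { toFun := mapSubrep e.symm hs
      invFun := mapSubrep e he
      left_inv := fun p => Subrepresentation.toSubmodule_injective <| by
        change (p.toSubmodule.map e.symm.toLinearMap).map e.toLinearMap = _
        rw [← Submodule.map_comp, LinearEquiv.comp_coe, LinearEquiv.symm_trans_self]
        exact Submodule.map_id _
      right_inv := fun p => Subrepresentation.toSubmodule_injective <| by
        change (p.toSubmodule.map e.toLinearMap).map e.symm.toLinearMap = _
        rw [← Submodule.map_comp, LinearEquiv.comp_coe, LinearEquiv.self_trans_symm]
        exact Submodule.map_id _
      map_rel_iff' := fun {p q} =>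
        Submodule.map_le_map_iff_of_injective (f := e.symm.toLinearMap) e.symm.injective
          p.toSubmodule q.toSubmodule }
  exact o.isSimpleOrder_iff.mpr hρ

theorem map_truncation_le (h : IsSignChange s φ ψ ε) (e : X ≃ₗ[ℂ] X')
    (he : ∀ g x, e (ρ g x) = ((ε g : ℤ) : ℂ) • ρ' g (e x)) (n : ℕ) :
    (truncation s φ ρ n).toSubmodule.map e.toLinearMap ≤ (truncation s ψ ρ' n).toSubmodule := by
  refine (Submodule.map_iSup _ _).trans_le (iSup_le fun p => ?_)
  have hp := twistedIso_mapSubrep e he p.1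
  exact le_iSup (fun q : {q : Subrepresentation ρ' //
    q.toRepresentation.IsIrreducible ∧ HasAValue s ψ q.toRepresentation n} => q.1.toSubmodule)
    ⟨mapSubrep e he p.1, hp.isIrreducible p.2.1, p.2.2.of_twistedIso h hp⟩

theorem TwistedIso.truncation (h : IsSignChange s φ ψ ε) (hρ : TwistedIso ε ρ ρ') (n : ℕ) :
    TwistedIso ε (truncation s φ ρ n).toRepresentation (truncation s ψ ρ' n).toRepresentation := by
  obtain ⟨e, he⟩ := hρ
  have h1 : (ConstructibleHecke.truncation s φ ρ n).toSubmodule.map e.toLinearMap =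
      (ConstructibleHecke.truncation s ψ ρ' n).toSubmodule := by
    refine le_antisymm (map_truncation_le h e he n) fun x hx => ?_
    exact ⟨e.symm x, map_truncation_le h.symm e.symm (twistedIso_symm_apply he) n
      (Submodule.mem_map_of_mem hx), e.apply_symm_apply x⟩
  exact ⟨e.ofSubmodules _ _ h1, fun g x => Subtype.ext (he g x)⟩

theorem TwistedIso.jInd (h : IsSignChange s φ ψ ε) (I : Set B)
    {Y : Type*} [AddCommGroup Y] [Module ℂ Y] {σ : Representation ℂ (parabolic s I) Y}
    {Y' : Type*} [AddCommGroup Y'] [Module ℂ Y'] {σ' : Representation ℂ (parabolic s I) Y'}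
    (hσ : TwistedIso (ε.comp (parabolic s I).subtype) σ σ') :
    TwistedIso ε (jInd s φ I σ) (jInd s ψ I σ') :=
  .directSum fun n => .truncation h (.ind _ (.truncation (h.parabolic I) hσ n)) n

end Truncation

/-! ### Constructible representations -/

/-- The twist by `ε` of a representation that is constructible with respect to `φ` is constructible
with respect to `ψ`. -/
theorem IsConstructible.of_twistedIso {B : Type b} {G : Type u} [Group G] {s : B → G} {φ : B → ℤ}
    {X : Type v} [AddCommGroup X] [Module ℂ X] {ρ : Representation ℂ G X}
    (hρ : IsConstructible s φ ρ) : ∀ {ψ : B → ℤ} {ε : G →* ℤˣ} (_ : IsSignChange s φ ψ ε)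
    {X' : Type v} [AddCommGroup X'] [Module ℂ X'] {ρ' : Representation ℂ G X'}
    (_ : TwistedIso ε ρ ρ'), IsConstructible s ψ ρ' := by
  induction hρ with
  | base s φ ρ hG hX =>
    intro ψ ε _ X' _ _ ρ' hρ'
    obtain ⟨e, -⟩ := hρ'
    exact .base s ψ ρ' hG (e.finrank_eq.symm.trans hX)
  | truncInd s φ ρ hG I hI σ _ hρ ih =>
    intro ψ ε h X' _ _ ρ' hρ'
    have hσ := twistedIso_twist (ε.comp (parabolic s I).subtype) σ
    refine .truncInd s ψ ρ' hG I hI _ (ih (h.parabolic I) hσ) (twistedIso_one_iff.mp ?_)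
    have := (hρ'.symm.trans (twistedIso_one_iff.mpr hρ)).trans (.jInd h I hσ)
    rwa [mul_one, signChar_mul_self] at this
  | sgnTruncInd s φ ρ hG I hI σ _ sgn hsgn hρ ih =>
    intro ψ ε h X' _ _ ρ' hρ'
    have hσ := twistedIso_twist (ε.comp (parabolic s I).subtype) σ
    refine .sgnTruncInd s ψ ρ' hG I hI _ (ih (h.parabolic I) hσ) sgn hsgn
      (twistedIso_one_iff.mp ?_)
    have := (((hρ'.symm.trans (twistedIso_one_iff.mpr hρ)).trans
      (twistedIso_twist sgn _).symm).trans (.jInd h I hσ)).trans (twistedIso_twist sgn _)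
    rwa [mul_one, mul_assoc (ε * sgn), signChar_mul_self] at this

end ConstructibleHecke

theorem mainTheorem6 {B : Type b} {W : Type u} [Group W] [Finite W] {M : CoxeterMatrix B}
    (cs : CoxeterSystem M W) (hM : IsCrystallographic M)
    {Sp Sm : Set B} (hS : IsCompl Sp Sm)
    (hconj : ∀ i ∈ Sp, ∀ j ∈ Sm, ¬ IsConj (cs.simple i) (cs.simple j))
    (φ : B → ℤ) (hφ : Star Sp Sm φ)
    {Λ : Type w} {X : Λ → Type v} [∀ l, AddCommGroup (X l)] [∀ l, Module ℂ (X l)]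
    (E : ∀ l, Representation ℂ W (X l)) (hE : IsIrrList E)
    (lamEps : Λ → Λ)
    (hlamEps : ∀ l, Nonempty
      ((E (lamEps l)).Equiv (twist (epsilon cs hS hconj φ hφ) (E l))))
    (α : Λ → ℕ) :
    IsConstructible cs.simple φ (sumWithMult E α id) ↔
      IsConstructible cs.simple (fun i => |φ i|) (sumWithMult E α lamEps) := by
  have h := isSignChange_abs cs hS hconj φ hφ
  have hsum : TwistedIso (epsilon cs hS hconj φ hφ) (sumWithMult E α id)
      (sumWithMult E α lamEps) := .directSum fun p => by
    have := (twistedIso_twist (epsilon cs hS hconj φ hφ) (E p.1)).trans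
      (twistedIso_one_iff.mpr (hlamEps p.1)).symm
    rwa [mul_one] at this
  exact ⟨fun hc => hc.of_twistedIso h hsum, fun hc => hc.of_twistedIso h.symm hsum.symm⟩
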